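/- **Setting.** Let $X$ be a (Hausdorff, second countable, finite-dimensional) complex manifold and let $\Omega\subsetneq X$ be a domain, i.e. a nonempty connected open subset. Let $k_\Omega$ be the Kobayashi pseudodistance of $\Omega$, i.e. the infimum of the lengths of chains of holomorphic discs, where the unit disc carries the Poincaré distance $\tfrac12\log\frac{1+r}{1-r}$, $r=\left|\frac{a-b}{1-\bar b a}\right|$. Assume that $\Omega$ is complete Kobayashi hyperbolic: $k_\Omega$ is a distance and $(\Omega,k_\Omega)$ is a complete metric space. *Metric compactification.* Let $C_*(\Omega)$ be the quotient of $C(\Omega,\mathbb R)$ (with locally uniform convergence) by the constant functions, with the quotient topology. Put $i_k(z)=[k_\Omega(z,\cdot)]\in C_*(\Omega)$; the metric compactification $\overline\Omega^{k}$ is the closure of $i_k(\Omega)$ in $C_*(\Omega)$. For $p\in\Omega$ and $\xi\in\overline\Omega^{k}\setminus i_k(\Omega)$ let $h_{p,\xi}$ be the representative of $\xi$ with $h_{p,\xi}(p)=0$, and for $R>0$ let $H_p(\xi,R)=\{z\in\Omega: h_{p,\xi}(z)<\tfrac12\log R\}$. *End compactification.* Let $(K_j)$ be an exhaustion of $\overline\Omega$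 (the closure in $X$) by compact sets with $K_j\subset\operatorname{int}(K_{j+1})$, the interior being relative to $\overline\Omega$. An end is a decreasing sequence $e=(F_j)$ in which $F_j$ is a connected component of $\overline\Omega\setminus K_j$. The end compactification $\overline\Omega^{\rm End}$ is the disjoint union of $\overline\Omega$ and the set of ends. A subset $U$ of it is open if $U\cap\overline\Omega$ is open in $\overline\Omega$ and, for every end $e=(F_j)\in U$, there is $j$ such that $U$ contains $F_j$ and all ends $(G_\nu)$ with $G_\nu=F_\nu$ for $\nu\le j$. Let $i_\Omega:\Omega\to\overline\Omega^{\rm End}$ be the inclusion and $\partial\overline\Omega^{\rm End}=\overline\Omega^{\rm End}\setminus\Omega$. Assume that $\overline\Omega^{\rm End}$ is sequentially compact. For $p\in\Omega$, $x\in\partial\overline\Omega^{\rm End}$ and $R>0$ put $$H^b_p(x,R)=\Big\{z\in\Omega:\liminf_{\Omega\ni w\to x}\big(k_\Omega(z,w)-k_\Omega(p,w)\big)<\tfrac12\log R\Big\},$$ and let $\mathscr H(x)$ be the set of all $\xi\in\overline\Omega^{k}\setminus i_k(\Omega)$ for which there is a sequence $(x_n)$ in $\Omega$ with $x_n\to x$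 in $\overline\Omega^{\rm End}$ and $i_k(x_n)\to\xi$ in $\overline\Omega^{k}$. **Proposition.** Fix $p\in\Omega$ and suppose that $\bigcap_{R>0}\overline{H^b_p(x,R)}=\{x\}$ for every $x\in\partial\overline\Omega^{\rm End}$, the closures being taken in $\overline\Omega^{\rm End}$. Then for every $x\in\partial\overline\Omega^{\rm End}$ and every $\xi\in\mathscr H(x)$, $$\bigcap_{R>0}\overline{H_p(\xi,R)}=\{x\}\quad\text{(closures in }\overline\Omega^{\rm End}).$$ In particular, there exists a continuous surjective map $F:\overline\Omega^{k}\to\overline\Omega^{\rm End}$ such that $F\circ i_k=i_\Omega$ on $\Omega$. -/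

import Mathlib

open Set Filter Topology
open scoped Manifold ContDiff

noncomputable section

/-! ## The Kobayashi distance -/

/-- The Poincaré distance of the unit disc of `ℂ`,
`ρ(a, b) = ½ log ((1 + r) / (1 - r))` with `r = |a - b| / |1 - conj b * a|`. -/
def poincareDist (a b : ℂ) : ℝ :=
  Real.artanh (‖a - b‖ / ‖1 - (starRingEnd ℂ) b * a‖)

/-- `IsDiscChain E x y l`: the points `x` and `y` of the complex manifold `M` (modelled on `E`)
are joined by a finite chain of holomorphic discs whose Poincaré lengths add up to `l`. -/
inductive IsDiscChain (E : Type*) [NormedAddCommGroup E] [NormedSpace ℂ E]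
    {M : Type*} [TopologicalSpace M] [ChartedSpace E M] : M → M → ℝ → Prop
  | refl (x : M) : IsDiscChain E x x 0
  | cons (f : ℂ → M) (hf : MDifferentiableOn 𝓘(ℂ, ℂ) 𝓘(ℂ, E) f (Metric.ball 0 1))
      (a b : ℂ) (ha : a ∈ Metric.ball (0 : ℂ) 1) (hb : b ∈ Metric.ball (0 : ℂ) 1)
      {y : M} {l : ℝ} (h : IsDiscChain E (f b) y l) :
      IsDiscChain E (f a) y (poincareDist a b + l)

/-- The Kobayashi (pseudo)distance: the infimum of the lengths of the chains of holomorphic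
discs from `x` to `y`. On a connected manifold such chains always exist. -/
def kobayashiDist (E : Type*) [NormedAddCommGroup E] [NormedSpace ℂ E]
    {M : Type*} [TopologicalSpace M] [ChartedSpace E M] (x y : M) : ℝ :=
  sInf {l : ℝ | IsDiscChain E x y l}

/-- A complex manifold is Kobayashi hyperbolic if its Kobayashi pseudodistance separates points. -/
class KobayashiHyperbolic (E : Type*) [NormedAddCommGroup E] [NormedSpace ℂ E]
    (M : Type*) [TopologicalSpace M] [ChartedSpace E M] : Prop where
  eq_of_kobayashiDist_eq_zero : ∀ x y : M, kobayashiDist E x y = 0 → x = y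

section KobayashiFacts

variable {E : Type*} [NormedAddCommGroup E] [NormedSpace ℂ E]
  {M : Type*} [TopologicalSpace M] [ChartedSpace E M]

theorem poincareDist_nonneg (a b : ℂ) : 0 ≤ poincareDist a b :=
  Real.artanh_nonneg (by positivity)

theorem poincareDist_comm (a b : ℂ) : poincareDist a b = poincareDist b a := by
  unfold poincareDist
  have h : ‖1 - (starRingEnd ℂ) b * a‖ = ‖1 - (starRingEnd ℂ) a * b‖ := by
    rw [← RCLike.norm_conj (1 - (starRingEnd ℂ) b * a)]
    congr 1
    simp [mul_comm]
  rw [h, norm_sub_rev]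

theorem IsDiscChain.nonneg {x y : M} {l : ℝ} (h : IsDiscChain E x y l) : 0 ≤ l := by
  induction h with
  | refl x => exact le_rfl
  | cons f hf a b ha hb h ih => exact add_nonneg (poincareDist_nonneg a b) ih

theorem IsDiscChain.trans {x y z : M} {l m : ℝ} (h : IsDiscChain E x y l)
    (h' : IsDiscChain E y z m) : IsDiscChain E x z (l + m) := by
  induction h with
  | refl x => simpa using h'
  | cons f hf a b ha hb h ih =>
    rw [add_assoc]
    exact IsDiscChain.cons f hf a b ha hb (ih h')

theorem IsDiscChain.symm {x y : M} {l : ℝ} (h : IsDiscChain E x y l) :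
    IsDiscChain E y x l := by
  induction h with
  | refl x => exact IsDiscChain.refl x
  | cons f hf a b ha hb h ih =>
    have h1 : IsDiscChain E (f b) (f a) (poincareDist b a + 0) :=
      IsDiscChain.cons f hf b a hb ha (IsDiscChain.refl (f a))
    rw [add_zero, poincareDist_comm] at h1
    rw [add_comm]
    exact ih.trans h1

theorem eventually_exists_isDiscChain [IsManifold 𝓘(ℂ, E) ω M] (x : M) :
    ∀ᶠ y in 𝓝 x, ∃ l, IsDiscChain E x y l := by
  have htarget : (chartAt E x).target ∈ 𝓝 (chartAt E x x) :=
    (chartAt E x).open_target.mem_nhds (mem_chart_target E x)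
  obtain ⟨r, hr, hball⟩ := Metric.mem_nhds_iff.1 htarget
  have hcont : ContinuousAt (chartAt E x) x :=
    (chartAt E x).continuousAt (mem_chart_source E x)
  have hsrc : (chartAt E x).source ∈ 𝓝 x :=
    (chartAt E x).open_source.mem_nhds (mem_chart_source E x)
  filter_upwards [hcont (Metric.ball_mem_nhds (chartAt E x x) (half_pos hr)), hsrc] with y hy hys
  set v : E := chartAt E x y - chartAt E x x with hv
  have hvr : ‖v‖ < r / 2 := by
    have hy' : chartAt E x y ∈ Metric.ball (chartAt E x x) (r / 2) := hy
    rwa [Metric.mem_ball, dist_eq_norm] at hy'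
  set g : ℂ → E := fun ζ => chartAt E x x + (2 * ζ) • v with hg
  have hmaps : MapsTo g (Metric.ball 0 1) (chartAt E x).target := by
    intro ζ hζ
    apply hball
    rw [Metric.mem_ball, dist_eq_norm] at *
    have hζ' : ‖ζ‖ < 1 := by simpa using hζ
    simp only [hg, add_sub_cancel_left, norm_smul, norm_mul, Complex.norm_ofNat]
    nlinarith [norm_nonneg v, norm_nonneg ζ]
  have hgd : MDifferentiableOn 𝓘(ℂ, ℂ) 𝓘(ℂ, E) g (Metric.ball 0 1) := by
    rw [mdifferentiableOn_iff_differentiableOn]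
    fun_prop
  have hchart : MDifferentiableOn 𝓘(ℂ, E) 𝓘(ℂ, E) (chartAt E x).symm (chartAt E x).target :=
    (contMDiffOn_chart_symm (I := 𝓘(ℂ, E)) (n := ω) (x := x)).mdifferentiableOn (by simp)
  have hf : MDifferentiableOn 𝓘(ℂ, ℂ) 𝓘(ℂ, E) ((chartAt E x).symm ∘ g) (Metric.ball 0 1) :=
    hchart.comp hgd hmaps
  have h0 : ((chartAt E x).symm ∘ g) 0 = x := by
    simp [hg, (chartAt E x).left_inv (mem_chart_source E x)]
  have h1 : ((chartAt E x).symm ∘ g) (1 / 2) = y := by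
    simp [hg, hv, (chartAt E x).left_inv hys]
  have key := IsDiscChain.cons (E := E) _ hf 0 (1 / 2) (by simp)
    (by rw [Metric.mem_ball, dist_zero_right]; norm_num)
    (IsDiscChain.refl (((chartAt E x).symm ∘ g) (1 / 2)))
  rw [h0, h1] at key
  exact ⟨_, key⟩

theorem exists_isDiscChain [IsManifold 𝓘(ℂ, E) ω M] [ConnectedSpace M] (x y : M) :
    ∃ l, IsDiscChain E x y l :=
  PreconnectedSpace.induction₂' (fun x y : M => ∃ l, IsDiscChain E x y l)
    (fun x => (eventually_exists_isDiscChain x).mono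
      fun _ ⟨l, hl⟩ => ⟨⟨l, hl⟩, ⟨l, hl.symm⟩⟩)
    ⟨fun _ _ _ ⟨_, hl⟩ ⟨_, hm⟩ => ⟨_, hl.trans hm⟩⟩ x y

theorem bddBelow_isDiscChain (x y : M) : BddBelow {l : ℝ | IsDiscChain E x y l} :=
  ⟨0, fun _ hl => IsDiscChain.nonneg hl⟩

theorem kobayashiDist_self (x : M) : kobayashiDist E x x = 0 :=
  le_antisymm (csInf_le (bddBelow_isDiscChain x x) (IsDiscChain.refl x))
    (Real.sInf_nonneg fun _ hl => IsDiscChain.nonneg hl)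

theorem kobayashiDist_comm (x y : M) : kobayashiDist E x y = kobayashiDist E y x := by
  unfold kobayashiDist
  congr 1
  ext l
  exact ⟨fun h => IsDiscChain.symm h, fun h => IsDiscChain.symm h⟩

theorem kobayashiDist_triangle [IsManifold 𝓘(ℂ, E) ω M] [ConnectedSpace M] (x y z : M) :
    kobayashiDist E x z ≤ kobayashiDist E x y + kobayashiDist E y z := by
  rw [← sub_le_iff_le_add]
  refine le_csInf (exists_isDiscChain x y) fun l hl => ?_
  rw [sub_le_iff_le_add, ← sub_le_iff_le_add']
  refine le_csInf (exists_isDiscChain y z) fun m hm => ?_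
  rw [sub_le_iff_le_add']
  exact csInf_le (bddBelow_isDiscChain x z) (IsDiscChain.trans hl hm)

end KobayashiFacts

/-- The manifold `M` seen as the metric space `(M, k_M)`. -/
def KobayashiSpace (E : Type*) [NormedAddCommGroup E] [NormedSpace ℂ E]
    (M : Type*) [TopologicalSpace M] [ChartedSpace E M] : Type _ := M

/-- The identity map from a manifold `M` to the metric space `(M, k_M)`. -/
def toKobayashi (E : Type*) [NormedAddCommGroup E] [NormedSpace ℂ E]
    {M : Type*} [TopologicalSpace M] [ChartedSpace E M] : M ≃ KobayashiSpace E M :=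
  Equiv.refl M

instance KobayashiSpace.instMetricSpace (E : Type*) [NormedAddCommGroup E] [NormedSpace ℂ E]
    (M : Type*) [TopologicalSpace M] [ChartedSpace E M] [IsManifold 𝓘(ℂ, E) ω M]
    [ConnectedSpace M] [KobayashiHyperbolic E M] : MetricSpace (KobayashiSpace E M) where
  dist x y := kobayashiDist E ((toKobayashi E).symm x) ((toKobayashi E).symm y)
  dist_self _ := kobayashiDist_self _
  dist_comm _ _ := kobayashiDist_comm _ _
  dist_triangle _ _ _ := kobayashiDist_triangle _ _ _
  eq_of_dist_eq_zero {x y} h := (toKobayashi E (M := M)).symm.injective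
    (KobayashiHyperbolic.eq_of_kobayashiDist_eq_zero _ _ h)

/-! ## The metric compactification of a metric space -/

/-- The subspace of constant functions of `C(S, ℝ)`. -/
def constantMaps (S : Type*) [TopologicalSpace S] : Submodule ℝ C(S, ℝ) where
  carrier := {f | ∃ c : ℝ, f = ContinuousMap.const S c}
  add_mem' := by
    rintro _ _ ⟨c, rfl⟩ ⟨d, rfl⟩
    exact ⟨c + d, rfl⟩
  zero_mem' := ⟨0, rfl⟩
  smul_mem' := by
    rintro a _ ⟨c, rfl⟩
    exact ⟨a • c, rfl⟩

/-- The space `C_*(S)` of continuous functions modulo constants, with the quotient of the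
topology of locally uniform convergence (the compact-open topology). -/
abbrev ModConstants (S : Type*) [TopologicalSpace S] : Type _ :=
  C(S, ℝ) ⧸ constantMaps S

/-- The map `x ↦ [d(x, ·)]` from a metric space `S` to `C_*(S)`. -/
def distClass {S : Type*} [MetricSpace S] (x : S) : ModConstants S :=
  (constantMaps S).mkQ ⟨fun z => dist x z, by fun_prop⟩

/-- The metric compactification of `S`: the closure of the image of `S` in `C_*(S)`. -/
def metricCompactification (S : Type*) [MetricSpace S] : Set (ModConstants S) :=
  closure (range (distClass (S := S)))

/-- The metric boundary of `S`. -/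
def metricBoundary (S : Type*) [MetricSpace S] : Set (ModConstants S) :=
  metricCompactification S \ range (distClass (S := S))

/-- The canonical map from `S` to its metric compactification. -/
def toMetricCompactification {S : Type*} [MetricSpace S] (x : S) : metricCompactification S :=
  ⟨distClass x, subset_closure (mem_range_self x)⟩

/-- The representative of a class in `C_*(S)` that vanishes at `p`; for `ξ` in the metric
boundary this is the horofunction `h_{p, ξ}`. -/
def normalizedRep {S : Type*} [MetricSpace S] (p : S) (ξ : ModConstants S) : S → ℝ :=
  Quotient.liftOn' ξ (fun f z => f z - f p) (by
    intro f g hfg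
    rw [Submodule.quotientRel_def] at hfg
    obtain ⟨c, hc⟩ := hfg
    funext z
    have hz : f z - g z = c := DFunLike.congr_fun hc z
    have hp : f p - g p = c := DFunLike.congr_fun hc p
    linarith)

/-- The horoball with pole `p`, center `ξ` and radius `R`. -/
def horoball {S : Type*} [MetricSpace S] (p : S) (ξ : ModConstants S) (R : ℝ) : Set S :=
  {z | normalizedRep p ξ z < 1 / 2 * Real.log R}

/-! ## The end compactification -/

/-- An end of a space `Y` with compact exhaustion `K`: a decreasing sequence `(F_j)` where `F_j`
is a connected component of `Y \ K_j`. -/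
structure SpaceEnd {Y : Type*} [TopologicalSpace Y] (K : CompactExhaustion Y) where
  comp : ℕ → Set Y
  isComponent : ∀ j, ∃ y ∈ (K j)ᶜ, comp j = connectedComponentIn (K j)ᶜ y
  succ_subset : ∀ j, comp (j + 1) ⊆ comp j

/-- The underlying set of the end compactification of `Y`: the points of `Y` and its ends. -/
inductive EndCompactification {Y : Type*} [TopologicalSpace Y] (K : CompactExhaustion Y) where
  | point (y : Y) : EndCompactification K
  | atEnd (e : SpaceEnd K) : EndCompactification K

/-- The basic set `F_j ⊔ {ends that agree with e up to j}` around the end `e = (F_j)`. -/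
def SpaceEnd.basicSet {Y : Type*} [TopologicalSpace Y] {K : CompactExhaustion Y}
    (e : SpaceEnd K) (j : ℕ) : Set (EndCompactification K) :=
  EndCompactification.point '' e.comp j ∪
    EndCompactification.atEnd '' {f : SpaceEnd K | ∀ i ≤ j, f.comp i = e.comp i}

theorem SpaceEnd.basicSet_antitone {Y : Type*} [TopologicalSpace Y] {K : CompactExhaustion Y}
    (e : SpaceEnd K) : Antitone e.basicSet := by
  intro i j hij
  refine union_subset_union (image_mono ?_) (image_mono ?_)
  · exact antitone_nat_of_succ_le e.succ_subset hij
  · exact fun f hf k hk => hf k (hk.trans hij)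

/-- A set is open if with each point `y` of `Y` it contains a neighbourhood of `y` in `Y`,
and with each end `e` one of the basic sets around `e`. -/
instance EndCompactification.instTopologicalSpace {Y : Type*} [TopologicalSpace Y]
    {K : CompactExhaustion Y} : TopologicalSpace (EndCompactification K) where
  IsOpen U := IsOpen (EndCompactification.point ⁻¹' U) ∧
    ∀ e : SpaceEnd K, EndCompactification.atEnd e ∈ U → ∃ j, e.basicSet j ⊆ U
  isOpen_univ := ⟨isOpen_univ, fun _ _ => ⟨0, subset_univ _⟩⟩
  isOpen_inter := by
    rintro U V ⟨hU, hU'⟩ ⟨hV, hV'⟩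
    refine ⟨hU.inter hV, fun e he => ?_⟩
    obtain ⟨i, hi⟩ := hU' e he.1
    obtain ⟨j, hj⟩ := hV' e he.2
    exact ⟨max i j, subset_inter
      ((e.basicSet_antitone (le_max_left i j)).trans hi)
      ((e.basicSet_antitone (le_max_right i j)).trans hj)⟩
  isOpen_sUnion := by
    intro 𝒰 h𝒰
    refine ⟨?_, fun e he => ?_⟩
    · rw [preimage_sUnion]
      exact isOpen_biUnion fun U hU => (h𝒰 U hU).1
    · obtain ⟨U, hU, heU⟩ := he
      obtain ⟨j, hj⟩ := (h𝒰 U hU).2 e heU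
      exact ⟨j, hj.trans (subset_sUnion_of_mem hU)⟩

/-! ## Domains -/

section Domain

variable {X : Type*} [TopologicalSpace X] {Ω : TopologicalSpace.Opens X}
  (K : CompactExhaustion (closure (Ω : Set X)))

/-- The inclusion of `Ω` in the end compactification of its closure. -/
def endInclusion (z : Ω) : EndCompactification K :=
  EndCompactification.point ⟨z, subset_closure z.2⟩

/-- The end boundary: the complement of `Ω` in the end compactification of its closure. -/
def endBoundary : Set (EndCompactification K) :=
  (range (endInclusion K))ᶜ

variable (E : Type*) [NormedAddCommGroup E] [NormedSpace ℂ E] [ChartedSpace E X]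

/-- The big horosphere with center `x`, pole `p` and radius `R`. -/
def bigHorosphere (p : Ω) (x : EndCompactification K) (R : ℝ) : Set Ω :=
  {z | liminf (fun w : Ω => kobayashiDist E z w - kobayashiDist E p w)
      (comap (endInclusion K) (𝓝 x)) < 1 / 2 * Real.log R}

/-- The set `𝓗(x)` of metric boundary points `ξ` such that some sequence in `Ω` converges to `x`
in the end compactification and to `ξ` in the metric compactification. -/
def horoFiber [IsManifold 𝓘(ℂ, E) ω X] [ConnectedSpace Ω] [KobayashiHyperbolic E Ω]
    (x : EndCompactification K) : Set (ModConstants (KobayashiSpace E Ω)) :=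
  {ξ | ξ ∈ metricBoundary (KobayashiSpace E Ω) ∧
    ∃ u : ℕ → Ω, Tendsto (fun n => endInclusion K (u n)) atTop (𝓝 x) ∧
      Tendsto (fun n => distClass (toKobayashi E (u n))) atTop (𝓝 ξ)}

end Domain

end

/-! A chain of discs can be cut at any prescribed length, so the Kobayashi distance is a length
metric; by Barth's theorem (`isHomeomorph_toKobayashi`) it induces the manifold topology.
Completeness then makes closed balls compact (Hopf–Rinow). In a proper length space every boundary
horofunction is unbounded below: if `u n` leaves all balls and tends to `ξ`, the points at distance
about `t` from `p` on almost shortest paths to `u n` accumulate at a point where the horofunction is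
at most `-t`.

For `ξ ∈ 𝓗(x)` the horofunction is a limit along one sequence tending to `x`, hence dominates the
liminf over all approaches to `x`. So horoballs lie in big horospheres, and their closures meet in
at most `x`. No horoball is empty, so sequential compactness puts some point in the intersection,
and that point must be `x` (`iInter_closure_horoball_eq`).

Consequently `ξ` determines `x`: a sequence of `Ω` tending to `ξ` can accumulate only at `x`, hence
converges to it. This defines `F` and gives `F ∘ i_k = i_Ω`; surjectivity comes from Arzelà–Ascoli.
Continuity passes from sequences in `Ω` to `F` by `continuousAt_of_tendsto_point`, where nested
components replace regularity of the target. -/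

/-! ## Length metrics and the Hopf–Rinow theorem -/

/-- Any two points of `S` can be joined up to an arbitrarily small error: the metric of `S` is a
length metric in the sense of approximate intermediate points. -/
def HasApproxIntermediatePoints (S : Type*) [MetricSpace S] : Prop :=
  ∀ (x y : S) (r s : ℝ), 0 < r → 0 < s → dist x y < r + s → ∃ z, dist x z < r ∧ dist z y < s

section Length

variable {S : Type*} [MetricSpace S]

/-- Every point of the ball is within `ε / 2` of a slightly smaller, compact ball, so an `ε / 2`-net
of the latter is an `ε`-net of the former. -/
theorem HasApproxIntermediatePoints.totallyBounded_closedBall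
    (hS : HasApproxIntermediatePoints S) (x : S) {ρ : ℝ}
    (h : ∀ r < ρ, IsCompact (Metric.closedBall x r)) :
    TotallyBounded (Metric.closedBall x ρ) := by
  rw [Metric.totallyBounded_iff]
  intro ε hε
  rcases lt_or_ge ρ ε with hρ | hρ
  · refine ⟨{x}, finite_singleton x, fun y hy => ?_⟩
    simpa using lt_of_le_of_lt hy hρ
  · obtain ⟨t, ht, hcov⟩ := Metric.totallyBounded_iff.1
      (h (ρ - ε / 4) (by linarith)).totallyBounded (ε / 2) (half_pos hε)
    refine ⟨t, ht, fun y hy => ?_⟩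
    have hy' : dist x y ≤ ρ := by rw [dist_comm]; exact hy
    obtain ⟨z, hxz, hzy⟩ := hS x y (ρ - ε / 4) (ε / 2) (by linarith) (by linarith) (by linarith)
    have hz : z ∈ Metric.closedBall x (ρ - ε / 4) := by
      rw [Metric.mem_closedBall, dist_comm]; exact hxz.le
    obtain ⟨w, hw, hzw⟩ := mem_iUnion₂.1 (hcov hz)
    refine mem_iUnion₂.2 ⟨w, hw, ?_⟩
    rw [Metric.mem_ball] at hzw ⊢
    linarith [dist_triangle y z w, dist_comm z y]

/-- **Hopf–Rinow–Cohn-Vossen**: a complete locally compact length space is proper. -/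
theorem HasApproxIntermediatePoints.properSpace [CompleteSpace S] [LocallyCompactSpace S]
    (hS : HasApproxIntermediatePoints S) : ProperSpace S := by
  refine ⟨fun x r₀ => ?_⟩
  by_contra hr₀
  set A : Set ℝ := {r | IsCompact (Metric.closedBall x r)} with hA
  have hmono : ∀ r ∈ A, ∀ r' ≤ r, r' ∈ A := fun r hr r' hr' =>
    IsCompact.of_isClosed_subset hr Metric.isClosed_closedBall (Metric.closedBall_subset_closedBall hr')
  have hbdd : BddAbove A := ⟨r₀, fun r hr => by
    by_contra hlt
    exact hr₀ (hmono r hr r₀ (not_le.1 hlt).le)⟩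
  have h0 : (0 : ℝ) ∈ A := by simp [hA]
  set ρ := sSup A with hρ
  have hρ0 : 0 ≤ ρ := le_csSup hbdd h0
  -- The supremum of the compact radii is attained; local compactness then lets the radius grow past
  -- it, a contradiction.
  have hC : IsCompact (Metric.closedBall x ρ) := by
    refine isCompact_iff_totallyBounded_isComplete.2
      ⟨hS.totallyBounded_closedBall x fun r hr => ?_, Metric.isClosed_closedBall.isComplete⟩
    obtain ⟨r', hr', hlt⟩ := exists_lt_of_lt_csSup ⟨0, h0⟩ hr
    exact hmono r' hr' r hlt.le
  obtain ⟨δ, hδ, hcomp⟩ := hC.exists_isCompact_cthickening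
  have hmem : ρ + δ / 2 ∈ A := by
    refine hcomp.of_isClosed_subset Metric.isClosed_closedBall fun y hy => ?_
    have hy' : dist x y ≤ ρ + δ / 2 := by rw [dist_comm]; exact hy
    -- Intermediate points require positive radii, so `ρ = 0` is treated apart.
    rcases hρ0.eq_or_lt with h | h
    · refine Metric.mem_cthickening_of_dist_le y x δ _ (by simp [hρ0]) ?_
      rw [dist_comm]; linarith
    · obtain ⟨z, hxz, hzy⟩ := hS x y ρ δ h hδ (by linarith)
      refine Metric.mem_cthickening_of_dist_le y z δ _ ?_ (by rw [dist_comm]; exact hzy.le)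
      rw [Metric.mem_closedBall, dist_comm]; exact hxz.le
  linarith [le_csSup hbdd hmem]

end Length

/-! ## Horofunctions -/

section Horofunctions

variable {S : Type*} [MetricSpace S]

theorem normalizedRep_mk (p z : S) (f : C(S, ℝ)) :
    normalizedRep p (Submodule.Quotient.mk f : ModConstants S) z = f z - f p := rfl

theorem normalizedRep_distClass (p x z : S) :
    normalizedRep p (distClass x) z = dist x z - dist x p := rfl

theorem continuous_normalizedRep (p z : S) :
    Continuous fun ξ : ModConstants S => normalizedRep p ξ z := by
  have h : Continuous fun f : C(S, ℝ) => f z - f p := by fun_prop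
  exact (QuotientAddGroup.isOpenQuotientMap_mk
    (N := (constantMaps S).toAddSubgroup)).isQuotientMap.continuous_iff.2 h

theorem normalizedRep_injective (p : S) :
    Function.Injective (normalizedRep p : ModConstants S → S → ℝ) := by
  intro ξ η h
  obtain ⟨f, rfl⟩ := Submodule.Quotient.mk_surjective _ ξ
  obtain ⟨g, rfl⟩ := Submodule.Quotient.mk_surjective _ η
  rw [Submodule.Quotient.eq]
  refine ⟨f p - g p, ?_⟩
  ext z
  have hz := congrFun h z
  rw [normalizedRep_mk, normalizedRep_mk] at hz
  simp only [ContinuousMap.sub_apply, ContinuousMap.const_apply]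
  linarith

theorem tendsto_normalizedRep {ι : Type*} {l : Filter ι} {u : ι → S} {ξ : ModConstants S}
    (h : Tendsto (fun n => distClass (u n)) l (𝓝 ξ)) (p z : S) :
    Tendsto (fun n => dist (u n) z - dist (u n) p) l (𝓝 (normalizedRep p ξ z)) :=
  ((continuous_normalizedRep p z).tendsto ξ).comp h

/-- The evaluations of normalized representatives are continuous, real-valued and separate classes.
An index is needed only to provide a base point of `S`. -/
theorem tendsto_distClass_unique {ι : Type*} {l : Filter ι} [l.NeBot] {u : ι → S}
    {ξ η : ModConstants S} (h : Tendsto (fun n => distClass (u n)) l (𝓝 ξ))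
    (h' : Tendsto (fun n => distClass (u n)) l (𝓝 η)) : ξ = η := by
  rcases isEmpty_or_nonempty ι with hι | ⟨⟨i⟩⟩
  · exact absurd (filter_eq_bot_of_isEmpty l) (NeBot.ne ‹_›)
  · exact normalizedRep_injective (u i) (funext fun z =>
      tendsto_nhds_unique (tendsto_normalizedRep h _ z) (tendsto_normalizedRep h' _ z))

theorem distClass_injective : Function.Injective (distClass (S := S)) := by
  intro x y h
  have h1 := congrFun (congrArg (normalizedRep x) h) y
  have h2 : dist x y - dist x x = dist y y - dist y x := h1
  rw [dist_self, dist_self, dist_comm y x] at h2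
  exact dist_eq_zero.1 (by linarith)

theorem continuous_distClass : Continuous (distClass (S := S)) := by
  have h : Continuous fun x : S => (⟨fun z => dist x z, by fun_prop⟩ : C(S, ℝ)) :=
    ContinuousMap.continuous_of_continuous_uncurry _ (by
      simp only [Function.uncurry_def, ContinuousMap.coe_mk]; fun_prop)
  exact (QuotientAddGroup.isOpenQuotientMap_mk
    (N := (constantMaps S).toAddSubgroup)).isQuotientMap.continuous.comp h

theorem exists_subseq_dist_tendsto_or [ProperSpace S] (p : S) (u : ℕ → S) :
    Tendsto (fun n => dist (u n) p) atTop atTop ∨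
      ∃ (y : S) (φ : ℕ → ℕ), StrictMono φ ∧ Tendsto (u ∘ φ) atTop (𝓝 y) := by
  by_cases h : Tendsto (fun n => dist (u n) p) atTop atTop
  · exact Or.inl h
  · right
    rw [tendsto_atTop] at h
    push Not at h
    obtain ⟨b, hb⟩ := h
    have hb' : ∃ᶠ n in atTop, u n ∈ Metric.closedBall p b :=
      hb.mono fun n hn => hn.le
    obtain ⟨y, -, φ, hφ, hlim⟩ := (isCompact_closedBall p b).tendsto_subseq' hb'
    exact ⟨y, φ, hφ, hlim⟩

/-- Moving from `p` towards the distant `u n` by about `t` lowers the distance to `u n` by `t`;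
properness gives a limit of these points. -/
theorem exists_normalizedRep_le [ProperSpace S] (hS : HasApproxIntermediatePoints S) {p : S}
    {u : ℕ → S} {ξ : ModConstants S} (h : Tendsto (fun n => distClass (u n)) atTop (𝓝 ξ))
    (hu : Tendsto (fun n => dist (u n) p) atTop atTop) {t : ℝ} (ht : 0 < t) :
    ∃ y, normalizedRep p ξ y ≤ -t := by
  have hev : ∀ᶠ n in atTop, ∃ z ∈ Metric.closedBall p (t + 1),
      dist (u n) z - dist (u n) p ≤ -t := by
    filter_upwards [hu.eventually_gt_atTop (t + 1)] with n hn
    -- The extra `1` is the slack that approximate intermediate points need; it only enlarges the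
    -- compact ball, not the bound `-t`.
    obtain ⟨z, hz, hz'⟩ := hS p (u n) (t + 1) (dist (u n) p - t) (by linarith) (by linarith)
      (by rw [dist_comm p]; linarith)
    refine ⟨z, ?_, ?_⟩
    · rw [Metric.mem_closedBall, dist_comm]; exact hz.le
    · rw [dist_comm] at hz'; linarith
  obtain ⟨N, hN⟩ := eventually_atTop.1 hev
  have : Nonempty S := ⟨p⟩
  choose! z hz hzt using hN
  obtain ⟨y, -, φ, hφ, hlim⟩ := (isCompact_closedBall p (t + 1)).tendsto_subseq'
    ((eventually_ge_atTop N).mono hz).frequently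
  refine ⟨y, ?_⟩
  have h1 := (tendsto_normalizedRep h p y).comp hφ.tendsto_atTop
  have h2 : Tendsto (fun n => -t + dist (z (φ n)) y) atTop (𝓝 (-t + 0)) :=
    tendsto_const_nhds.add (tendsto_iff_dist_tendsto_zero.1 hlim)
  rw [add_zero] at h2
  refine le_of_tendsto_of_tendsto h1 h2 ?_
  filter_upwards [hφ.tendsto_atTop.eventually_ge_atTop N] with n hn
  have := hzt _ hn
  have := dist_triangle (u (φ n)) (z (φ n)) y
  simp only [Function.comp_apply]
  linarith

theorem mem_range_distClass_of_tendsto {u : ℕ → S} {ξ : ModConstants S}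
    (h : Tendsto (fun n => distClass (u n)) atTop (𝓝 ξ)) {y : S} {φ : ℕ → ℕ} (hφ : StrictMono φ)
    (hy : Tendsto (u ∘ φ) atTop (𝓝 y)) : ξ = distClass y :=
  tendsto_distClass_unique (h.comp hφ.tendsto_atTop) ((continuous_distClass.tendsto y).comp hy)

/-- Horofunctions of a proper length space are unbounded below. -/
theorem exists_normalizedRep_le_of_mem_metricBoundary [ProperSpace S]
    (hS : HasApproxIntermediatePoints S) (p : S)
    {u : ℕ → S} {ξ : ModConstants S} (h : Tendsto (fun n => distClass (u n)) atTop (𝓝 ξ))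
    (hξ : ξ ∉ range (distClass (S := S))) {t : ℝ} (ht : 0 < t) :
    ∃ y, normalizedRep p ξ y ≤ -t := by
  rcases exists_subseq_dist_tendsto_or p u with hu | ⟨y, φ, hφ, hy⟩
  · exact exists_normalizedRep_le hS h hu ht
  · exact absurd ⟨y, (mem_range_distClass_of_tendsto h hφ hy).symm⟩ hξ

/-- The canonical map of a proper length space to its metric compactification is an embedding. -/
theorem tendsto_of_tendsto_distClass [ProperSpace S] (hS : HasApproxIntermediatePoints S)
    {u : ℕ → S} {z : S} (h : Tendsto (fun n => distClass (u n)) atTop (𝓝 (distClass z))) :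
    Tendsto u atTop (𝓝 z) := by
  refine tendsto_of_subseq_tendsto fun ns hns => ?_
  have h' := h.comp hns
  rcases exists_subseq_dist_tendsto_or z (u ∘ ns) with hu | ⟨y, φ, hφ, hy⟩
  -- Escape is impossible: it would give the limit a value at most `-1`, while `dist z ·` is
  -- nonnegative.
  · obtain ⟨y, hy⟩ := exists_normalizedRep_le hS (u := u ∘ ns) h' hu one_pos
    rw [normalizedRep_distClass, dist_self] at hy
    linarith [dist_nonneg (x := z) (y := y)]
  · have : z = y := distClass_injective
      (mem_range_distClass_of_tendsto (u := u ∘ ns) h' hφ hy)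
    exact ⟨φ, this ▸ hy⟩

/-- Arzelà–Ascoli: normalized distance functions are 1-Lipschitz and vanish at `p`, hence lie
pointwise in `[-dist x p, dist x p]`. -/
theorem exists_subseq_tendsto_distClass [ProperSpace S] (u : ℕ → S) :
    ∃ ξ ∈ metricCompactification S, ∃ φ : ℕ → ℕ, StrictMono φ ∧
      Tendsto (fun n => distClass (u (φ n))) atTop (𝓝 ξ) := by
  set p := u 0
  set T : Set C(S, ℝ) := {f | LipschitzWith 1 f ∧ f p = 0} with hT
  have hequi : Equicontinuous ((↑) : T → S → ℝ) :=
    LipschitzWith.uniformEquicontinuous _ 1 (fun f => f.2.1) |>.equicontinuous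
  have hTc : IsCompact T := by
    refine ArzelaAscoli.isCompact_of_equicontinuous T ?_ hequi
    have himg : ContinuousMap.toFun '' T =
        {f : S → ℝ | LipschitzWith 1 f ∧ f p = 0} := by
      ext f
      constructor
      · rintro ⟨g, hg, rfl⟩
        exact hg
      · exact fun hf => ⟨⟨f, hf.1.continuous⟩, hf, rfl⟩
    rw [himg]
    refine (isCompact_univ_pi fun x : S => isCompact_Icc (a := -dist x p) (b := dist x p))
      |>.of_isClosed_subset ?_ ?_
    · simp only [lipschitzWith_iff_dist_le_mul, ofPred_and, ofPred_forall]
      refine IsClosed.inter (isClosed_iInter fun x => isClosed_iInter fun y =>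
        isClosed_le (by fun_prop) (by fun_prop)) (isClosed_eq (by fun_prop) (by fun_prop))
    · intro f hf x _
      have := hf.1.dist_le_mul x p
      rw [hf.2, Real.dist_eq, sub_zero, NNReal.coe_one, one_mul] at this
      exact abs_le.1 this
  set v : ℕ → C(S, ℝ) := fun n =>
    ⟨fun z => dist (u n) z, by fun_prop⟩ - ContinuousMap.const S (dist (u n) p)
  have hv : ∀ n, v n ∈ T := fun n => ⟨by
    refine LipschitzWith.of_dist_le_mul fun x y => ?_
    simp only [v, ContinuousMap.sub_apply, ContinuousMap.coe_mk, ContinuousMap.const_apply,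
      dist_sub_right, NNReal.coe_one, one_mul]
    exact dist_dist_dist_le_right _ _ _, by simp [v]⟩
  have hvc : ∀ n, (constantMaps S).mkQ (v n) = distClass (u n) := fun n => by
    refine (Submodule.Quotient.eq _).2 ⟨-dist (u n) p, ?_⟩
    ext z
    simp [v]
  obtain ⟨f, -, φ, hφ, hlim⟩ := hTc.tendsto_subseq hv
  have hlim' : Tendsto (fun n => distClass (u (φ n))) atTop (𝓝 ((constantMaps S).mkQ f)) := by
    simp_rw [← hvc]
    exact ((QuotientAddGroup.isOpenQuotientMap_mk
      (N := (constantMaps S).toAddSubgroup)).isQuotientMap.continuous.tendsto f).comp hlim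
  exact ⟨_, mem_closure_of_tendsto hlim' (Eventually.of_forall fun n => mem_range_self _),
    φ, hφ, hlim'⟩

/-- Allows points of the metric compactification to be reached by sequences. -/
theorem firstCountableTopology_modConstants [ProperSpace S] :
    FirstCountableTopology (ModConstants S) :=
  QuotientAddGroup.instFirstCountableTopology (constantMaps S).toAddSubgroup

end Horofunctions

/-! ## Holomorphic discs -/

section Disc

/-- The disc automorphism taking `0` to `a`, used to normalize links of chains. -/
theorem norm_mobius_lt_one {a ζ : ℂ} (ha : ‖a‖ < 1) (hζ : ‖ζ‖ < 1) :
    1 + (starRingEnd ℂ) a * ζ ≠ 0 ∧ ‖(ζ + a) / (1 + (starRingEnd ℂ) a * ζ)‖ < 1 := by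
  have hne : 1 + (starRingEnd ℂ) a * ζ ≠ 0 := by
    intro h
    have h1 : (starRingEnd ℂ) a * ζ = -1 := by linear_combination h
    have h2 := congrArg norm h1
    rw [norm_mul, RCLike.norm_conj, norm_neg, norm_one] at h2
    nlinarith [norm_nonneg a, norm_nonneg ζ]
  refine ⟨hne, ?_⟩
  rw [norm_div, div_lt_one (norm_pos_iff.2 hne)]
  refine lt_of_pow_lt_pow_left₀ 2 (norm_nonneg _) ?_
  have hid : ‖1 + (starRingEnd ℂ) a * ζ‖ ^ 2 - ‖ζ + a‖ ^ 2 =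
      (1 - ‖a‖ ^ 2) * (1 - ‖ζ‖ ^ 2) := by
    simp only [← Complex.normSq_eq_norm_sq, Complex.normSq_apply, Complex.add_re, Complex.add_im,
      Complex.mul_re, Complex.mul_im, Complex.conj_re, Complex.conj_im, Complex.one_re,
      Complex.one_im]
    ring
  have h1 : 0 < 1 - ‖a‖ ^ 2 := by nlinarith [norm_nonneg a]
  have h2 : 0 < 1 - ‖ζ‖ ^ 2 := by nlinarith [norm_nonneg ζ]
  nlinarith [mul_pos h1 h2]

variable {E : Type*} [NormedAddCommGroup E] [NormedSpace ℂ E]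
  {M : Type*} [TopologicalSpace M] [ChartedSpace E M]

/-- A link of a disc chain may be normalized to join the centre of the disc to a point of its
positive radius. -/
theorem exists_normalized_disc {f : ℂ → M}
    (hf : MDifferentiableOn 𝓘(ℂ, ℂ) 𝓘(ℂ, E) f (Metric.ball 0 1)) {a b : ℂ}
    (ha : a ∈ Metric.ball (0 : ℂ) 1) (hb : b ∈ Metric.ball (0 : ℂ) 1) :
    ∃ g : ℂ → M, MDifferentiableOn 𝓘(ℂ, ℂ) 𝓘(ℂ, E) g (Metric.ball 0 1) ∧ g 0 = f a ∧
      g (Real.tanh (poincareDist a b) : ℝ) = f b := by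
  rw [mem_ball_zero_iff] at ha hb
  obtain ⟨hne, hlt⟩ := norm_mobius_lt_one (a := -a) (by rwa [norm_neg]) hb
  rw [map_neg, neg_mul, ← sub_eq_add_neg] at hne hlt
  rw [← sub_eq_add_neg] at hlt
  -- `w` is the image of `b` under the automorphism taking `a` to `0`; the rotation `u` below
  -- carries the positive radius through `w`.
  set w : ℂ := (b - a) / (1 - (starRingEnd ℂ) a * b) with hw
  have hdist : poincareDist a b = Real.artanh ‖w‖ := by
    rw [poincareDist_comm, poincareDist, hw, norm_div]
  have htanh : Real.tanh (poincareDist a b) = ‖w‖ := by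
    rw [hdist, Real.tanh_artanh ⟨by linarith [norm_nonneg w], hlt⟩]
  obtain ⟨u, hu, huw⟩ : ∃ u : ℂ, ‖u‖ = 1 ∧ u * ‖w‖ = w := by
    by_cases h0 : w = 0
    · exact ⟨1, by simp, by simp [h0]⟩
    · have h0' : (‖w‖ : ℂ) ≠ 0 := by simpa using h0
      exact ⟨w / ‖w‖, by simp [h0], by field_simp⟩
  have hball : ∀ ζ ∈ Metric.ball (0 : ℂ) 1, ‖u * ζ‖ < 1 := fun ζ hζ => by
    rw [norm_mul, hu, one_mul]; exact mem_ball_zero_iff.1 hζ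
  refine ⟨fun ζ => f ((u * ζ + a) / (1 + (starRingEnd ℂ) a * (u * ζ))), ?_, by simp, ?_⟩
  · refine hf.comp (u := Metric.ball 0 1) ?_ fun ζ hζ =>
      mem_ball_zero_iff.2 (norm_mobius_lt_one ha (hball ζ hζ)).2
    rw [mdifferentiableOn_iff_differentiableOn]
    exact DifferentiableOn.div (by fun_prop) (by fun_prop)
      fun ζ hζ => (norm_mobius_lt_one ha (hball ζ hζ)).1
  · have hne' := (norm_mobius_lt_one ha hlt).1
    rw [htanh]
    simp only [huw]
    congr 1
    have hwm : w * (1 - (starRingEnd ℂ) a * b) = b - a := div_mul_cancel₀ _ hne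
    rw [div_eq_iff hne']
    linear_combination hwm

theorem tanh_mem_ball (t : ℝ) : ((Real.tanh t : ℝ) : ℂ) ∈ Metric.ball (0 : ℂ) 1 := by
  rw [mem_ball_zero_iff, Complex.norm_real, Real.norm_eq_abs]
  exact Real.abs_tanh_lt_one t

theorem continuous_real_tanh : Continuous Real.tanh := by
  simp only [funext Real.tanh_eq_sinh_div_cosh]
  exact Real.continuous_sinh.div Real.continuous_cosh fun t => (Real.cosh_pos t).ne'

/-- `tanh` parametrizes the real diameter by Poincaré arc length, so links can be subdivided without
increasing the total length. -/
theorem poincareDist_tanh {s t : ℝ} (h : s ≤ t) :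
    poincareDist (Real.tanh s : ℝ) (Real.tanh t : ℝ) = t - s := by
  have hs := Real.cosh_pos s
  have ht := Real.cosh_pos t
  have hst := Real.cosh_pos (t - s)
  have hden : 1 - Real.tanh t * Real.tanh s = Real.cosh (t - s) / (Real.cosh t * Real.cosh s) := by
    rw [Real.cosh_sub, Real.tanh_eq_sinh_div_cosh, Real.tanh_eq_sinh_div_cosh]
    field_simp
  have hnum : Real.tanh t - Real.tanh s = Real.sinh (t - s) / (Real.cosh t * Real.cosh s) := by
    rw [Real.sinh_sub, Real.tanh_eq_sinh_div_cosh, Real.tanh_eq_sinh_div_cosh]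
    field_simp
  have hsinh : 0 ≤ Real.sinh (t - s) := Real.sinh_nonneg_iff.2 (by linarith)
  have hx : ‖((Real.tanh s : ℝ) : ℂ) - (Real.tanh t : ℝ)‖ /
      ‖1 - (starRingEnd ℂ) ((Real.tanh t : ℝ) : ℂ) * (Real.tanh s : ℝ)‖ = Real.tanh (t - s) := by
    rw [Complex.conj_ofReal, norm_sub_rev]
    norm_cast
    rw [hnum, hden, Real.norm_of_nonneg (by positivity), Real.norm_of_nonneg (by positivity),
      Real.tanh_eq_sinh_div_cosh]
    field_simp
  rw [poincareDist, hx, Real.artanh_tanh]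

theorem isDiscChain_tanh {g : ℂ → M}
    (hg : MDifferentiableOn 𝓘(ℂ, ℂ) 𝓘(ℂ, E) g (Metric.ball 0 1)) {s t : ℝ} (h : s ≤ t) :
    IsDiscChain E (g (Real.tanh s : ℝ)) (g (Real.tanh t : ℝ)) (t - s) := by
  have := IsDiscChain.cons g hg _ _ (tanh_mem_ball s) (tanh_mem_ball t) (IsDiscChain.refl _)
  rwa [poincareDist_tanh h, add_zero] at this

/-- The cut either falls in the first link, which is split along a geodesic of the disc, or is
passed on to the rest of the chain. -/
theorem IsDiscChain.exists_between {x y : M} {l : ℝ} (h : IsDiscChain E x y l) {t : ℝ}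
    (ht : 0 ≤ t) (htl : t ≤ l) : ∃ z, IsDiscChain E x z t ∧ IsDiscChain E z y (l - t) := by
  induction h generalizing t with
  | refl x =>
    obtain rfl : t = 0 := le_antisymm htl ht
    exact ⟨x, IsDiscChain.refl x, by simpa using IsDiscChain.refl x⟩
  | @cons f hf a b ha hb y l h ih =>
    rcases le_total t (poincareDist a b) with hle | hle
    · obtain ⟨g, hg, h0, h1⟩ := exists_normalized_disc hf ha hb
      have hfirst := isDiscChain_tanh hg ht
      have hsecond := isDiscChain_tanh hg hle
      rw [Real.tanh_zero, Complex.ofReal_zero, h0, sub_zero] at hfirst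
      rw [h1] at hsecond
      refine ⟨_, hfirst, ?_⟩
      rw [add_sub_right_comm]
      exact hsecond.trans h
    · obtain ⟨z, hz, hz'⟩ := ih (t := t - poincareDist a b) (by linarith) (by linarith)
      refine ⟨z, ?_, by convert hz' using 1; ring⟩
      have := IsDiscChain.cons f hf a b ha hb hz
      rwa [add_sub_cancel] at this

/-- The images of the geodesic segments in the discs join up to a connected set. It makes Kobayashi
balls connected. -/
theorem IsDiscChain.exists_isPreconnected {x y : M} {l : ℝ} (h : IsDiscChain E x y l) :
    ∃ T : Set M, IsPreconnected T ∧ x ∈ T ∧ y ∈ T ∧ ∀ z ∈ T, ∃ t ≤ l, IsDiscChain E x z t := by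
  induction h with
  | refl x =>
    refine ⟨{x}, isPreconnected_singleton, rfl, rfl, ?_⟩
    rintro z rfl
    exact ⟨0, le_rfl, IsDiscChain.refl z⟩
  | @cons f hf a b ha hb y l h ih =>
    obtain ⟨T, hT, hbT, hyT, hTl⟩ := ih
    obtain ⟨g, hg, h0, h1⟩ := exists_normalized_disc hf ha hb
    have hρ := poincareDist_nonneg a b
    set γ : ℝ → M := fun t => g (Real.tanh t : ℝ) with hγ
    have hγc : Continuous γ :=
      hg.continuousOn.comp_continuous
        (Complex.continuous_ofReal.comp continuous_real_tanh) tanh_mem_ball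
    have h0' : γ 0 = f a := by simp [hγ, h0]
    refine ⟨γ '' Icc 0 (poincareDist a b) ∪ T, ?_, Or.inl ⟨0, ⟨le_rfl, hρ⟩, h0'⟩, Or.inr hyT, ?_⟩
    · exact IsPreconnected.union (f b) ⟨poincareDist a b, ⟨hρ, le_rfl⟩, h1⟩ hbT
        (isPreconnected_Icc.image γ hγc.continuousOn) hT
    · rintro z (⟨t, ht, rfl⟩ | hz)
      · refine ⟨t, by linarith [ht.2, h.nonneg], ?_⟩
        have := isDiscChain_tanh hg ht.1
        rwa [Real.tanh_zero, Complex.ofReal_zero, h0, sub_zero] at this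
      · obtain ⟨t, ht, hz⟩ := hTl z hz
        exact ⟨_, by linarith, IsDiscChain.cons f hf a b ha hb hz⟩

end Disc

/-! ## The topology of the Kobayashi distance -/

section Kobayashi

variable {E : Type*} [NormedAddCommGroup E] [NormedSpace ℂ E]
  {M : Type*} [TopologicalSpace M] [ChartedSpace E M]

theorem kobayashiDist_le {x y : M} {l : ℝ} (h : IsDiscChain E x y l) : kobayashiDist E x y ≤ l :=
  csInf_le (bddBelow_isDiscChain x y) h

variable [IsManifold 𝓘(ℂ, E) ω M]

/-- An affine disc in a chart, scaled to reach `y` at parameter `tanh (ε / 2)`, has cost `ε / 2`; it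
fits in the chart once `y` is close to `x`. -/
theorem eventually_kobayashiDist_lt (x : M) {ε : ℝ} (hε : 0 < ε) :
    ∀ᶠ y in 𝓝 x, kobayashiDist E x y < ε := by
  obtain ⟨r, hr, hball⟩ := Metric.mem_nhds_iff.1
    ((chartAt E x).open_target.mem_nhds (mem_chart_target E x))
  have htε : 0 < Real.tanh (ε / 2) := by
    rw [Real.tanh_eq_sinh_div_cosh]
    exact div_pos (Real.sinh_pos_iff.2 (half_pos hε)) (Real.cosh_pos _)
  have hcont : ContinuousAt (chartAt E x) x :=
    (chartAt E x).continuousAt (mem_chart_source E x)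
  filter_upwards [hcont (Metric.ball_mem_nhds (chartAt E x x) (mul_pos htε hr)),
    (chartAt E x).open_source.mem_nhds (mem_chart_source E x)] with y hy hys
  set τ := Real.tanh (ε / 2) with hτ
  have hτ0 : (τ : ℂ) ≠ 0 := by exact_mod_cast htε.ne'
  set v : E := chartAt E x y - chartAt E x x with hv
  have hvr : ‖v‖ < τ * r := by
    have hy' : chartAt E x y ∈ Metric.ball (chartAt E x x) (τ * r) := hy
    rwa [Metric.mem_ball, dist_eq_norm] at hy'
  set g : ℂ → E := fun ζ => chartAt E x x + (ζ / τ) • v with hg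
  have hmaps : MapsTo g (Metric.ball 0 1) (chartAt E x).target := by
    intro ζ hζ
    apply hball
    rw [mem_ball_zero_iff] at hζ
    rw [Metric.mem_ball, dist_eq_norm]
    simp only [hg, add_sub_cancel_left, norm_smul, norm_div, Complex.norm_real,
      Real.norm_of_nonneg htε.le]
    rw [div_mul_eq_mul_div, div_lt_iff₀ htε]
    nlinarith [norm_nonneg v, norm_nonneg ζ]
  have hgd : MDifferentiableOn 𝓘(ℂ, ℂ) 𝓘(ℂ, E) g (Metric.ball 0 1) := by
    rw [mdifferentiableOn_iff_differentiableOn]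
    fun_prop
  have hchart : MDifferentiableOn 𝓘(ℂ, E) 𝓘(ℂ, E) (chartAt E x).symm (chartAt E x).target :=
    (contMDiffOn_chart_symm (I := 𝓘(ℂ, E)) (n := ω) (x := x)).mdifferentiableOn (by simp)
  have key := isDiscChain_tanh (E := E) (hchart.comp hgd hmaps) (half_pos hε).le
  rw [Real.tanh_zero, Complex.ofReal_zero, ← hτ, sub_zero] at key
  have h0 : ((chartAt E x).symm ∘ g) 0 = x := by
    simp [hg, (chartAt E x).left_inv (mem_chart_source E x)]
  have h1 : ((chartAt E x).symm ∘ g) τ = y := by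
    simp [hg, hv, (chartAt E x).left_inv hys, hτ0]
  rw [h0, h1] at key
  linarith [kobayashiDist_le key]

variable [ConnectedSpace M]

theorem exists_isDiscChain_lt {x y : M} {r : ℝ} (h : kobayashiDist E x y < r) :
    ∃ l < r, IsDiscChain E x y l := by
  obtain ⟨l, hl, hlr⟩ := exists_lt_of_csInf_lt (exists_isDiscChain (E := E) x y) h
  exact ⟨l, hlr, hl⟩

theorem isPreconnected_kobayashiBall (x : M) (r : ℝ) :
    IsPreconnected {y | kobayashiDist E x y < r} := by
  refine isPreconnected_of_forall x fun y hy => ?_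
  obtain ⟨l, hlr, hl⟩ := exists_isDiscChain_lt hy
  obtain ⟨T, hT, hxT, hyT, hTl⟩ := hl.exists_isPreconnected
  refine ⟨T, fun z hz => ?_, hxT, hyT, hT⟩
  obtain ⟨t, ht, hz⟩ := hTl z hz
  exact (kobayashiDist_le hz).trans_lt (ht.trans_lt hlr)

variable [KobayashiHyperbolic E M]

theorem hasApproxIntermediatePoints_kobayashiSpace :
    HasApproxIntermediatePoints (KobayashiSpace E M) := by
  intro x y r s hr hs hxy
  obtain ⟨l, hl, hch⟩ := exists_isDiscChain_lt (E := E) (M := M) hxy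
  have hl0 := hch.nonneg
  rcases lt_or_ge l r with h | h
  · refine ⟨y, (kobayashiDist_le hch).trans_lt h, by rwa [dist_self]⟩
  -- Cutting at `t` leaves pieces of length `t < r` and `l - t < s`.
  · obtain ⟨t, ht⟩ := exists_between (show max 0 (l - s) < r from max_lt hr (by linarith))
    obtain ⟨z, hz, hz'⟩ := hch.exists_between ((le_max_left _ _).trans ht.1.le)
      (ht.2.le.trans h)
    refine ⟨toKobayashi E z, (kobayashiDist_le hz).trans_lt ht.2,
      (kobayashiDist_le hz').trans_lt ?_⟩
    linarith [(le_max_right 0 (l - s)).trans_lt ht.1]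

theorem continuous_toKobayashi : Continuous (toKobayashi E (M := M)) := by
  refine continuous_iff_continuousAt.2 fun x => Metric.tendsto_nhds.2 fun ε hε => ?_
  filter_upwards [eventually_kobayashiDist_lt (E := E) x hε] with y hy
  rw [dist_comm]
  exact hy

/-- **Barth's theorem**: the Kobayashi distance of a hyperbolic manifold induces its topology. -/
theorem isHomeomorph_toKobayashi [T2Space M] [LocallyCompactSpace M] :
    IsHomeomorph (toKobayashi E (M := M)) := by
  refine isHomeomorph_iff_exists_inverse.2 ⟨continuous_toKobayashi, (toKobayashi E).symm,
    (toKobayashi E).left_inv, (toKobayashi E).right_inv, ?_⟩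
  refine continuous_iff_continuousAt.2 fun x s hs => ?_
  set x' : M := (toKobayashi E).symm x with hx'
  obtain ⟨C, hC, hCs, hCc⟩ := local_compact_nhds hs
  have hfr : IsCompact (frontier C) :=
    hCc.of_isClosed_subset isClosed_frontier hCc.isClosed.frontier_subset
  obtain ⟨δ, hδ, hδfr⟩ : ∃ δ > 0, ∀ y ∈ frontier C, δ ≤ kobayashiDist E x' y := by
    rcases (frontier C).eq_empty_or_nonempty with he | hne
    · exact ⟨1, one_pos, by simp [he]⟩
    · have hd : Continuous fun y : M => dist x (toKobayashi E y) :=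
        continuous_const.dist continuous_toKobayashi
      obtain ⟨y, hy, hmin⟩ := hfr.exists_isMinOn hne hd.continuousOn
      refine ⟨dist x (toKobayashi E y), dist_pos.2 ?_, fun z hz => hmin hz⟩
      rintro rfl
      exact hy.2 (mem_interior_iff_mem_nhds.2 hC)
  refine mem_map.2 (Filter.mem_of_superset (Metric.ball_mem_nhds x hδ) ?_)
  -- The ball is connected, contains an interior point of `C` and misses the frontier, so it cannot
  -- leave `C`.
  have hsub : {y | kobayashiDist E x' y < δ} ⊆ C := by
    refine (isPreconnected_kobayashiBall x' δ).subset_of_closure_inter_subset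
      isOpen_interior ⟨x', ?_, mem_interior_iff_mem_nhds.2 hC⟩ ?_ |>.trans interior_subset
    · simpa [kobayashiDist_self] using hδ
    · rintro y ⟨hy, hyδ⟩
      by_contra hyC
      have : y ∈ frontier C := ⟨closure_mono interior_subset hy, hyC⟩
      exact absurd (hδfr y this) (not_le.2 hyδ)
  intro y hy
  rw [Metric.mem_ball, dist_comm] at hy
  exact hCs (hsub hy)

theorem properSpace_kobayashiSpace [T2Space M] [LocallyCompactSpace M]
    [CompleteSpace (KobayashiSpace E M)] : ProperSpace (KobayashiSpace E M) := by
  have : LocallyCompactSpace (KobayashiSpace E M) :=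
    (isHomeomorph_toKobayashi (E := E) (M := M)).homeomorph.symm.isClosedEmbedding
      |>.locallyCompactSpace
  exact hasApproxIntermediatePoints_kobayashiSpace.properSpace

end Kobayashi

/-! ## Convergence in the end compactification -/

/-- Components are relatively closed in `F`, even where they are not open. -/
theorem mem_connectedComponentIn_of_mem_closure {Y : Type*} [TopologicalSpace Y] {F : Set Y}
    {w y : Y} (hy : y ∈ closure (connectedComponentIn F w)) (hyF : y ∈ F) :
    y ∈ connectedComponentIn F w := by
  by_cases hw : w ∈ F
  · have hpre : IsPreconnected (insert y (connectedComponentIn F w)) :=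
      isPreconnected_connectedComponentIn.subset_closure (subset_insert _ _)
        (insert_subset hy subset_closure)
    exact hpre.subset_connectedComponentIn (mem_insert_of_mem _ (mem_connectedComponentIn hw))
      (insert_subset hyF (connectedComponentIn_subset F w)) (mem_insert _ _)
  · simp [connectedComponentIn_eq_empty hw] at hy

namespace SpaceEnd

variable {Y : Type*} [TopologicalSpace Y] {K : CompactExhaustion Y} (e : SpaceEnd K)

theorem comp_antitone : Antitone e.comp := antitone_nat_of_succ_le e.succ_subset

theorem comp_subset_compl (j : ℕ) : e.comp j ⊆ (K j)ᶜ := by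
  obtain ⟨y, -, h⟩ := e.isComponent j
  exact h ▸ connectedComponentIn_subset _ _

theorem comp_nonempty (j : ℕ) : (e.comp j).Nonempty := by
  obtain ⟨y, hy, h⟩ := e.isComponent j
  exact ⟨y, h ▸ mem_connectedComponentIn hy⟩

theorem comp_eq_connectedComponentIn {j : ℕ} {y : Y} (hy : y ∈ e.comp j) :
    e.comp j = connectedComponentIn (K j)ᶜ y := by
  obtain ⟨w, -, h⟩ := e.isComponent j
  rw [h] at hy ⊢
  exact connectedComponentIn_eq hy

variable {e} in
theorem comp_eq_of_mem {f : SpaceEnd K} {j : ℕ} {y : Y} (hy : y ∈ e.comp j) (hy' : y ∈ f.comp j)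
    {i : ℕ} (hi : i ≤ j) : f.comp i = e.comp i :=
  (f.comp_eq_connectedComponentIn (f.comp_antitone hi hy')).trans
    (e.comp_eq_connectedComponentIn (e.comp_antitone hi hy)).symm

/-- Since `K j` lies in the interior of `K (j + 1)`, limit points avoid `K j` and so stay in the
same component of its complement. -/
theorem closure_comp_succ_subset [T2Space Y] (j : ℕ) : closure (e.comp (j + 1)) ⊆ e.comp j := by
  intro y hy
  have hyK : y ∈ (K j)ᶜ := by
    have h1 : e.comp (j + 1) ⊆ (interior (K (j + 1)))ᶜ :=
      (e.comp_subset_compl _).trans (compl_subset_compl.2 interior_subset)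
    exact fun h => closure_minimal h1 isOpen_interior.isClosed_compl hy
      (K.subset_interior_succ j h)
  obtain ⟨w, -, h⟩ := e.isComponent j
  have hy' := closure_mono (e.succ_subset j) hy
  rw [h] at hy' ⊢
  exact mem_connectedComponentIn_of_mem_closure hy' hyK

end SpaceEnd

namespace EndCompactification

variable {Y : Type*} [TopologicalSpace Y] {K : CompactExhaustion Y}

theorem isOpen_iff {U : Set (EndCompactification K)} :
    IsOpen U ↔ IsOpen (point ⁻¹' U) ∧ ∀ e : SpaceEnd K, atEnd e ∈ U → ∃ j, e.basicSet j ⊆ U :=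
  Iff.rfl

theorem point_injective : Function.Injective (point (K := K)) := fun _ _ h => by
  injection h

theorem isOpenEmbedding_point : IsOpenEmbedding (point (K := K)) := by
  refine .of_continuous_injective_isOpenMap ⟨fun U hU => hU.1⟩ point_injective fun U hU => ?_
  rw [isOpen_iff, point_injective.preimage_image]
  exact ⟨hU, fun e he => by obtain ⟨y, -, hy⟩ := he; cases hy⟩

theorem isClosed_point_image [T2Space Y] {C : Set Y} (hC : IsCompact C) :
    IsClosed (point (K := K) '' C) := by
  rw [← isOpen_compl_iff, isOpen_iff, preimage_compl, point_injective.preimage_image]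
  refine ⟨hC.isClosed.isOpen_compl, fun e _ => ?_⟩
  obtain ⟨j, hj⟩ := K.exists_superset_of_isCompact hC
  refine ⟨j, ?_⟩
  rintro _ (⟨y, hy, rfl⟩ | ⟨f, -, rfl⟩)
  · rintro ⟨z, hz, hzy⟩
    exact e.comp_subset_compl j hy (hj (point_injective hzy ▸ hz))
  · rintro ⟨z, -, hz⟩
    cases hz

theorem eventually_notMem_of_tendsto_atEnd [T2Space Y] {ι : Type*} {l : Filter ι} {u : ι → Y}
    {e : SpaceEnd K} (h : Tendsto (fun n => point (u n)) l (𝓝 (atEnd e))) (j : ℕ) :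
    ∀ᶠ n in l, u n ∉ K j := by
  have hmem : (point (K := K) '' K j)ᶜ ∈ 𝓝 (atEnd e) :=
    (isClosed_point_image (K.isCompact j)).isOpen_compl.mem_nhds (by
      rintro ⟨z, -, hz⟩
      cases hz)
  exact (h.eventually_mem hmem).mono fun n hn hmem => hn (mem_image_of_mem _ hmem)

/-- A sequence of points converging to an end eventually enters each of its components, even
though these need not be open. -/
theorem eventually_mem_comp_of_tendsto_atEnd [T2Space Y] {u : ℕ → Y}
    {e : SpaceEnd K} (h : Tendsto (fun n => point (u n)) atTop (𝓝 (atEnd e))) (j : ℕ) :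
    ∀ᶠ n in atTop, u n ∈ e.comp j := by
  set A : Set Y := range u \ e.comp j with hA
  have hAfin : ∀ i, (A ∩ K i).Finite := fun i => by
    obtain ⟨N, hN⟩ := eventually_atTop.1 (eventually_notMem_of_tendsto_atEnd h i)
    refine ((finite_Iio N).image u).subset ?_
    rintro _ ⟨⟨⟨n, rfl⟩, -⟩, hn⟩
    exact ⟨n, not_le.1 fun hle => hN n hle hn, rfl⟩
  -- The sequence leaves every `K i`, so `A` is locally finite and hence closed.
  have hAopen : IsOpen Aᶜ := by
    refine isOpen_iff_mem_nhds.2 fun y hy => ?_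
    obtain ⟨i, hi⟩ := K.exists_mem_nhds y
    filter_upwards [hi, (hAfin i).isClosed.isOpen_compl.mem_nhds fun h => hy h.1] with z hz hz' hzA
    exact hz' ⟨hzA, hz⟩
  set U : Set (EndCompactification K) :=
    point '' Aᶜ ∪ atEnd '' {f : SpaceEnd K | Disjoint (f.comp j) A} with hU
  have hpre : point ⁻¹' U = Aᶜ := by
    ext y
    simp [hU, point_injective.eq_iff]
  have hUopen : IsOpen U := by
    -- Level `j` suffices, because ends agreeing up to `j` share the component that must miss `A`.
    refine isOpen_iff.2 ⟨hpre ▸ hAopen, fun f hf => ⟨j, ?_⟩⟩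
    have hfA : Disjoint (f.comp j) A := by simpa [hU] using hf
    rintro _ (⟨y, hy, rfl⟩ | ⟨g, hg, rfl⟩)
    · exact Or.inl ⟨y, fun hyA => hfA.le_bot ⟨hy, hyA⟩, rfl⟩
    · refine Or.inr ⟨g, ?_, rfl⟩
      rw [mem_ofPred_eq, hg j le_rfl]
      exact hfA
  have heU : atEnd e ∈ U := Or.inr ⟨e, disjoint_sdiff_right, rfl⟩
  filter_upwards [h (hUopen.mem_nhds heU)] with n hn
  have hn' : u n ∈ Aᶜ := by rw [← hpre]; exact hn
  by_contra hnot
  exact hn' ⟨mem_range_self n, hnot⟩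

theorem tendsto_atEnd {ι : Type*} {l : Filter ι} {u : ι → Y} {e : SpaceEnd K}
    (h : ∀ j, ∀ᶠ n in l, u n ∈ e.comp j) : Tendsto (fun n => point (u n)) l (𝓝 (atEnd e)) := by
  refine tendsto_nhds.2 fun U hU he => ?_
  obtain ⟨j, hj⟩ := hU.2 e he
  exact (h j).mono fun n hn => hj (Or.inl (mem_image_of_mem _ hn))

/-- If the end compactification is sequentially compact, then, outside a large compact set, a
subset of `Y` lies in finitely many of the components of the complement of `K j`. -/
theorem exists_finset_components [T2Space Y] [SeqCompactSpace (EndCompactification K)]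
    (D : Set Y) (j : ℕ) :
    ∃ (i : ℕ) (s : Finset Y), ∀ v ∈ D, v ∉ K i → ∃ w ∈ s, v ∈ connectedComponentIn (K j)ᶜ w := by
  classical
  by_contra! hcon
  -- Otherwise there are points escaping every `K i` with no two in one component at level `j`. A
  -- subsequential limit cannot be a point, by escape, nor an end, whose component would contain two
  -- of them.
  obtain ⟨f, hf, hfr⟩ := exists_seq_of_forall_finset_exists
    (fun a : ℕ × Y => a.2 ∈ D ∧ a.2 ∉ K a.1)
    (fun a b => a.1 < b.1 ∧ b.2 ∉ connectedComponentIn (K j)ᶜ a.2) (by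
      intro s _
      obtain ⟨v, hv, hvK, hvs⟩ := hcon (s.sup Prod.fst + 1) (s.image Prod.snd)
      exact ⟨(s.sup Prod.fst + 1, v), ⟨hv, hvK⟩, fun a ha =>
        ⟨Nat.lt_succ_of_le (Finset.le_sup (f := Prod.fst) ha),
          hvs a.2 (Finset.mem_image_of_mem _ ha)⟩⟩)
  have hmono : StrictMono fun n => (f n).1 := strictMono_nat_of_lt_succ fun n =>
    (hfr n (n + 1) n.lt_succ_self).1
  have hesc : ∀ i, ∀ n ≥ i, (f n).2 ∉ K i := fun i n hn h =>
    (hf n).2 (K.subset (hn.trans (hmono.id_le n)) h)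
  obtain ⟨x, φ, hφ, hlim⟩ := SeqCompactSpace.tendsto_subseq fun n => point (K := K) (f n).2
  cases x with
  | point y =>
    obtain ⟨i, hi⟩ := K.exists_mem_nhds y
    have hlim' : Tendsto (fun n => (f (φ n)).2) atTop (𝓝 y) :=
      isOpenEmbedding_point.tendsto_nhds_iff.2 hlim
    obtain ⟨n, hn, hn'⟩ := ((hlim'.eventually_mem hi).and (eventually_ge_atTop i)).exists
    exact hesc i _ (hn'.trans (hφ.id_le n)) hn
  | atEnd e =>
    obtain ⟨N, hN⟩ := eventually_atTop.1 (eventually_mem_comp_of_tendsto_atEnd hlim j)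
    refine (hfr (φ N) (φ (N + 1)) (hφ N.lt_succ_self)).2 ?_
    rw [← e.comp_eq_connectedComponentIn (hN N le_rfl)]
    exact hN (N + 1) N.le_succ

/-- Density alone does not suffice, as components need not be open. Far out, `D` meets only finitely
many of them, so a point of `e.comp j` lies in the closure of the trace of `D` on one, necessarily
its own. -/
theorem comp_inter_nonempty_of_dense [T2Space Y] [SeqCompactSpace (EndCompactification K)]
    {D : Set Y} (hD : Dense D) (e : SpaceEnd K) (j : ℕ) : (e.comp j ∩ D).Nonempty := by
  obtain ⟨i, s, hs⟩ := exists_finset_components (K := K) D j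
  obtain ⟨y, hy⟩ := e.comp_nonempty (max i j)
  have hopen : IsOpen (K (max i j))ᶜ := (K.isCompact _).isClosed.isOpen_compl
  have hcov : (K (max i j))ᶜ ∩ D ⊆ ⋃ w ∈ s, connectedComponentIn (K j)ᶜ w ∩ D := by
    rintro v ⟨hvK, hvD⟩
    obtain ⟨w, hw, hvw⟩ := hs v hvD fun h => hvK (K.subset (le_max_left _ _) h)
    exact mem_iUnion₂.2 ⟨w, hw, hvw, hvD⟩
  have hcl := closure_mono hcov (hD.open_subset_closure_inter hopen (e.comp_subset_compl _ hy))
  rw [s.closure_biUnion] at hcl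
  obtain ⟨w, -, hyw⟩ := mem_iUnion₂.1 hcl
  have hyj := e.comp_antitone (le_max_right i j) hy
  have hmem := mem_connectedComponentIn_of_mem_closure (closure_mono inter_subset_left hyw)
    (e.comp_subset_compl j hyj)
  rw [e.comp_eq_connectedComponentIn hyj, ← connectedComponentIn_eq hmem]
  exact closure_nonempty_iff.1 ⟨y, hyw⟩

/-- Every point of a sequentially compact end compactification of a first countable space is the
limit of a sequence in a given dense subset of the space. -/
theorem exists_seq_tendsto_of_dense [T2Space Y] [FirstCountableTopology Y]
    [SeqCompactSpace (EndCompactification K)]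
    {D : Set Y} (hD : Dense D) (x : EndCompactification K) :
    ∃ u : ℕ → Y, (∀ n, u n ∈ D) ∧ Tendsto (fun n => point (u n)) atTop (𝓝 x) := by
  cases x with
  | point y =>
    obtain ⟨u, hu, hlim⟩ := mem_closure_iff_seq_limit.1 (hD y)
    exact ⟨u, hu, isOpenEmbedding_point.tendsto_nhds_iff.1 hlim⟩
  | atEnd e =>
    choose u hu using fun j => comp_inter_nonempty_of_dense hD e j
    refine ⟨u, fun n => (hu n).2, tendsto_atEnd fun j => ?_⟩
    filter_upwards [eventually_ge_atTop j] with n hn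
    exact e.comp_antitone hn (hu n).1

theorem tendsto_point_unique [T2Space Y] {u : ℕ → Y} {y : Y} {x : EndCompactification K}
    (h : Tendsto u atTop (𝓝 y)) (hx : Tendsto (fun n => point (u n)) atTop (𝓝 x)) :
    x = point y := by
  cases x with
  | point z =>
    rw [tendsto_nhds_unique (isOpenEmbedding_point.tendsto_nhds_iff.2 hx) h]
  | atEnd e =>
    obtain ⟨i, hi⟩ := K.exists_mem_nhds y
    obtain ⟨n, hn, hn'⟩ := ((h.eventually_mem hi).and (eventually_notMem_of_tendsto_atEnd hx i)).exists
    exact absurd hn hn'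

/-- If the values of `F` are the limits of a map `g` into `Y` along all sequences in a dense set,
then `F` is continuous. (The end compactification need not be regular.) -/
theorem continuousAt_of_tendsto_point [T2Space Y] [LocallyCompactSpace Y] {Z W : Type*}
    [TopologicalSpace Z] [FirstCountableTopology Z] {i : W → Z} {g : W → Y}
    {F : Z → EndCompactification K} {ξ : Z} (hi : DenseRange i)
    (hF : ∀ ζ, ∀ v : ℕ → W, Tendsto (fun n => i (v n)) atTop (𝓝 ζ) →
      Tendsto (fun n => point (g (v n))) atTop (𝓝 (F ζ))) :
    ContinuousAt F ξ := by
  have hseq : ∀ ζ, ∃ v : ℕ → W, Tendsto (fun n => i (v n)) atTop (𝓝 ζ) := fun ζ => by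
    obtain ⟨z, hz, hlim⟩ := mem_closure_iff_seq_limit.1 (hi ζ)
    choose v hv using hz
    exact ⟨v, by simpa only [hv] using hlim⟩
  -- First countability turns the sequential condition at `ξ` into one on a neighbourhood, which is
  -- also a neighbourhood of all nearby `ζ`.
  have hcomap : ∀ s : Set Y, (∀ v : ℕ → W, Tendsto (fun n => i (v n)) atTop (𝓝 ξ) →
      ∀ᶠ n in atTop, g (v n) ∈ s) → ∀ᶠ ζ in 𝓝 ξ, ∀ v : ℕ → W,
        Tendsto (fun n => i (v n)) atTop (𝓝 ζ) → ∀ᶠ n in atTop, g (v n) ∈ s := by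
    intro s hs
    have h1 : Tendsto g (comap i (𝓝 ξ)) (𝓟 s) := tendsto_of_seq_tendsto fun v hv =>
      tendsto_principal.2 (hs v (tendsto_comap_iff.1 hv))
    obtain ⟨O, hO, hOs⟩ := mem_comap.1 (tendsto_principal.1 h1)
    filter_upwards [eventually_mem_nhds_iff.2 hO] with ζ hζ v hv
    exact (hv.eventually_mem hζ).mono fun n hn => hOs hn
  intro U hU
  rw [mem_map]
  cases hx : F ξ with
  | point y =>
    rw [hx] at hU
    obtain ⟨C, hC, hCU, hCc⟩ := local_compact_nhds
      (isOpenEmbedding_point.continuous.continuousAt.preimage_mem_nhds hU)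
    filter_upwards [hcomap C fun v hv => by
      have := hF ξ v hv
      rw [hx] at this
      exact isOpenEmbedding_point.tendsto_nhds_iff.2 this hC] with ζ hζ
    obtain ⟨v, hv⟩ := hseq ζ
    have hmem : F ζ ∈ point '' C := (isClosed_point_image hCc).mem_of_tendsto (hF ζ v hv)
      ((hζ v hv).mono fun n hn => mem_image_of_mem _ hn)
    exact image_subset_iff.2 hCU hmem
  | atEnd e =>
    rw [hx] at hU
    obtain ⟨O, hOU, hO, heO⟩ := mem_nhds_iff.1 hU
    obtain ⟨j, hj⟩ := hO.2 e heO
    -- One level beyond `j`: limits of points of `e.comp (j + 1)` still belong to the basic set of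
    -- level `j`.
    filter_upwards [hcomap (e.comp (j + 1)) fun v hv => by
      have := hF ξ v hv
      rw [hx] at this
      exact eventually_mem_comp_of_tendsto_atEnd this (j + 1)] with ζ hζ
    obtain ⟨v, hv⟩ := hseq ζ
    have hlim := hF ζ v hv
    refine hOU (hj ?_)
    cases hζx : F ζ with
    | point y =>
      rw [hζx] at hlim
      exact Or.inl ⟨y, e.closure_comp_succ_subset j (mem_closure_of_tendsto
        (isOpenEmbedding_point.tendsto_nhds_iff.2 hlim) (hζ v hv)), rfl⟩
    | atEnd f =>
      rw [hζx] at hlim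
      obtain ⟨n, hn, hn'⟩ :=
        ((hζ v hv).and (eventually_mem_comp_of_tendsto_atEnd hlim (j + 1))).exists
      exact Or.inr ⟨f, fun k hk => SpaceEnd.comp_eq_of_mem hn hn' (hk.trans j.le_succ), rfl⟩

end EndCompactification

/-! ## Horospheres and the comparison of the compactifications -/

section Inclusion

variable {X : Type*} [TopologicalSpace X] {Ω : TopologicalSpace.Opens X}
  {K : CompactExhaustion (closure (Ω : Set X))}

theorem tendsto_endInclusion_iff {ι : Type*} {l : Filter ι} {v : ι → Ω} {z : Ω} :
    Tendsto (fun n => endInclusion K (v n)) l (𝓝 (endInclusion K z)) ↔ Tendsto v l (𝓝 z) := by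
  rw [tendsto_subtype_rng]
  exact EndCompactification.isOpenEmbedding_point.tendsto_nhds_iff.symm.trans tendsto_subtype_rng

theorem eq_endInclusion_of_tendsto [T2Space X] {v : ℕ → Ω} {z : Ω} {x : EndCompactification K}
    (h : Tendsto v atTop (𝓝 z)) (hx : Tendsto (fun n => endInclusion K (v n)) atTop (𝓝 x)) :
    x = endInclusion K z := by
  have h' : Tendsto (fun n => (⟨v n, subset_closure (v n).2⟩ : closure (Ω : Set X))) atTop
      (𝓝 ⟨z, subset_closure z.2⟩) := tendsto_subtype_rng.2
      ((continuous_subtype_val.tendsto z).comp h)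
  exact EndCompactification.tendsto_point_unique h' hx

theorem exists_seq_tendsto_endInclusion [T2Space X] [FirstCountableTopology X]
    [SeqCompactSpace (EndCompactification K)] (x : EndCompactification K) :
    ∃ v : ℕ → Ω, Tendsto (fun n => endInclusion K (v n)) atTop (𝓝 x) := by
  have hD : Dense {y : closure (Ω : Set X) | (y : X) ∈ Ω} := by
    intro y
    rw [closure_subtype]
    convert y.2
    ext z
    exact ⟨by rintro ⟨w, hw, rfl⟩; exact hw, fun hz => ⟨⟨z, subset_closure hz⟩, hz, rfl⟩⟩
  obtain ⟨u, hu, hlim⟩ := EndCompactification.exists_seq_tendsto_of_dense hD x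
  exact ⟨fun n => ⟨u n, hu n⟩, hlim⟩

end Inclusion

section Domain

variable {E : Type*} [NormedAddCommGroup E] [NormedSpace ℂ E]
  {X : Type*} [TopologicalSpace X] [ChartedSpace E X] [IsManifold 𝓘(ℂ, E) ω X]
  {Ω : TopologicalSpace.Opens X} [ConnectedSpace Ω] [KobayashiHyperbolic E Ω]
  {K : CompactExhaustion (closure (Ω : Set X))}

/-- A liminf over all approaches to `x` is at most the limit along the sequence defining `ξ`. -/
theorem horoball_subset_bigHorosphere {x : EndCompactification K}
    {ξ : ModConstants (KobayashiSpace E Ω)} (hξ : ξ ∈ horoFiber K E x) (p : Ω) (R : ℝ) :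
    toKobayashi E ⁻¹' horoball (toKobayashi E p) ξ R ⊆ bigHorosphere K E p x R := by
  obtain ⟨-, u, hux, huξ⟩ := hξ
  intro z hz
  have hlim : Tendsto (fun n => kobayashiDist E z (u n) - kobayashiDist E p (u n)) atTop
      (𝓝 (normalizedRep (toKobayashi E p) ξ (toKobayashi E z))) := by
    convert tendsto_normalizedRep huξ (toKobayashi E p) (toKobayashi E z) using 2
    rw [dist_comm, dist_comm _ (toKobayashi E p)]
    rfl
  -- Boundedness makes the comparison of the two real-valued liminfs legitimate.
  have hbound : ∀ w : Ω, |kobayashiDist E z w - kobayashiDist E p w| ≤ kobayashiDist E z p :=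
    fun w => abs_sub_le_iff.2
      ⟨by linarith [kobayashiDist_triangle (E := E) z p w],
        by linarith [kobayashiDist_triangle (E := E) p z w, kobayashiDist_comm (E := E) p z]⟩
  refine lt_of_le_of_lt ?_ (show normalizedRep (toKobayashi E p) ξ (toKobayashi E z) < _ from hz)
  rw [← hlim.liminf_eq]
  have hle : map u atTop ≤ comap (endInclusion K) (𝓝 x) := tendsto_comap_iff.2 hux
  refine liminf_le_liminf_of_le (f := comap (endInclusion K) (𝓝 x)) (g := map u atTop)
    (u := fun w : Ω => kobayashiDist E z w - kobayashiDist E p w) hle ?_ ?_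
  · exact isBoundedUnder_of ⟨-kobayashiDist E z p, fun w => (abs_le.1 (hbound w)).1⟩
  · exact IsBoundedUnder.isCoboundedUnder_ge
      (isBoundedUnder_of ⟨kobayashiDist E z p, fun w => (abs_le.1 (hbound w)).2⟩)

theorem tendsto_distClass_toKobayashi {ι : Type*} {l : Filter ι} {v : ι → Ω} {z : Ω}
    (h : Tendsto v l (𝓝 z)) : Tendsto (fun n => distClass (toKobayashi E (v n))) l
      (𝓝 (distClass (toKobayashi E z))) :=
  ((continuous_distClass.comp continuous_toKobayashi).tendsto z).comp h

theorem mem_endBoundary_of_tendsto {v : ℕ → Ω} {x : EndCompactification K}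
    {ξ : ModConstants (KobayashiSpace E Ω)} (hξ : ξ ∉ range (distClass (S := KobayashiSpace E Ω)))
    (hvx : Tendsto (fun n => endInclusion K (v n)) atTop (𝓝 x))
    (hvξ : Tendsto (fun n => distClass (toKobayashi E (v n))) atTop (𝓝 ξ)) :
    x ∈ endBoundary K := by
  rintro ⟨z, rfl⟩
  exact hξ ⟨toKobayashi E z, tendsto_distClass_unique
    (tendsto_distClass_toKobayashi (tendsto_endInclusion_iff.1 hvx)) hvξ⟩

variable [T2Space X] [LocallyCompactSpace Ω] [CompleteSpace (KobayashiSpace E Ω)]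

theorem tendsto_of_tendsto_distClass_toKobayashi {v : ℕ → Ω} {z : Ω}
    (h : Tendsto (fun n => distClass (toKobayashi E (v n))) atTop
      (𝓝 (distClass (toKobayashi E z)))) : Tendsto v atTop (𝓝 z) := by
  have := properSpace_kobayashiSpace (E := E) (M := Ω)
  exact (isHomeomorph_toKobayashi (E := E) (M := Ω)).isInducing.tendsto_nhds_iff.2
    (tendsto_of_tendsto_distClass hasApproxIntermediatePoints_kobayashiSpace h)

/-- The big horospheres give one inclusion. For the other, points with horofunction tending to `-∞`
eventually enter every horoball, and any limit of them can only be `x`. -/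
theorem iInter_closure_horoball_eq [SeqCompactSpace (EndCompactification K)] {p : Ω}
    {x : EndCompactification K}
    (hp : ⋂ (R : ℝ) (_ : 0 < R), closure (endInclusion K '' bigHorosphere K E p x R) = {x})
    {ξ : ModConstants (KobayashiSpace E Ω)} (hξ : ξ ∈ horoFiber K E x) :
    ⋂ (R : ℝ) (_ : 0 < R), closure (endInclusion K ''
      (toKobayashi E ⁻¹' horoball (toKobayashi E p) ξ R)) = {x} := by
  have := properSpace_kobayashiSpace (E := E) (M := Ω)
  have hsub : ⋂ (R : ℝ) (_ : 0 < R), closure (endInclusion K ''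
      (toKobayashi E ⁻¹' horoball (toKobayashi E p) ξ R)) ⊆ {x} := by
    rw [← hp]
    exact iInter₂_mono fun R _ =>
      closure_mono (image_mono (horoball_subset_bigHorosphere hξ p R))
  refine hsub.antisymm ?_
  obtain ⟨hξb, u, -, huξ⟩ := hξ
  have hy : ∀ n : ℕ, ∃ y, normalizedRep (toKobayashi E p) ξ y ≤ -((n : ℝ) + 1) := fun n =>
    exists_normalizedRep_le_of_mem_metricBoundary hasApproxIntermediatePoints_kobayashiSpace
      _ huξ hξb.2 (by positivity)
  choose y hy using hy
  obtain ⟨x', φ, hφ, hlim⟩ := SeqCompactSpace.tendsto_subseq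
    fun n => endInclusion K ((toKobayashi E).symm (y n))
  have hx' : x' ∈ ⋂ (R : ℝ) (_ : 0 < R), closure (endInclusion K ''
      (toKobayashi E ⁻¹' horoball (toKobayashi E p) ξ R)) := by
    refine mem_iInter₂.2 fun R _ => mem_closure_of_tendsto hlim ?_
    obtain ⟨N, hN⟩ := exists_nat_gt (-(1 / 2 * Real.log R))
    filter_upwards [eventually_ge_atTop N] with n hn
    refine mem_image_of_mem _ ((hy (φ n)).trans_lt ?_)
    have : (N : ℝ) ≤ φ n := by exact_mod_cast hn.trans (hφ.id_le n)
    linarith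
  rintro _ rfl
  rwa [hsub hx'] at hx'

/-- A sequence of `Ω` tending to `ξ` subconverges in the end compactification, and its limit cannot
be in `Ω`. -/
theorem exists_horoFiber [SeqCompactSpace (EndCompactification K)]
    {ξ : ModConstants (KobayashiSpace E Ω)} (hξ : ξ ∈ metricBoundary (KobayashiSpace E Ω)) :
    ∃ x ∈ endBoundary K, ξ ∈ horoFiber K E x := by
  have := properSpace_kobayashiSpace (E := E) (M := Ω)
  have := firstCountableTopology_modConstants (S := KobayashiSpace E Ω)
  obtain ⟨η, hη, hlim⟩ := mem_closure_iff_seq_limit.1 hξ.1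
  choose v hv using hη
  obtain ⟨x, φ, hφ, hx⟩ := SeqCompactSpace.tendsto_subseq
    fun n => endInclusion K ((toKobayashi E).symm (v n))
  have hvξ : Tendsto (fun n => distClass (toKobayashi E ((toKobayashi E).symm (v (φ n))))) atTop
      (𝓝 ξ) := by
    simp only [Equiv.apply_symm_apply, hv]
    exact hlim.comp hφ.tendsto_atTop
  exact ⟨x, mem_endBoundary_of_tendsto hξ.2 hx hvξ, hξ, _, hx, hvξ⟩

/-- A point `ξ` of the metric compactification and a point `x` of the end compactification
correspond to each other if they are the same point of `Ω`, or are boundary points with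
`ξ ∈ 𝓗(x)`. -/
def CompactificationRel (K : CompactExhaustion (closure (Ω : Set X)))
    (ξ : metricCompactification (KobayashiSpace E Ω)) (x : EndCompactification K) : Prop :=
  (∃ z : Ω, ξ = toMetricCompactification (toKobayashi E z) ∧ x = endInclusion K z) ∨
    x ∈ endBoundary K ∧ ξ.1 ∈ horoFiber K E x

theorem exists_compactificationRel [SeqCompactSpace (EndCompactification K)]
    (ξ : metricCompactification (KobayashiSpace E Ω)) : ∃ x, CompactificationRel K ξ x := by
  by_cases h : ξ.1 ∈ range (distClass (S := KobayashiSpace E Ω))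
  · obtain ⟨z, hz⟩ := h
    exact ⟨endInclusion K ((toKobayashi E).symm z), Or.inl ⟨_, Subtype.ext hz.symm, rfl⟩⟩
  · obtain ⟨x, hx, hξ⟩ := exists_horoFiber (K := K) ⟨ξ.2, h⟩
    exact ⟨x, Or.inr ⟨hx, hξ⟩⟩

/-- For a boundary point, `ξ` lies in both `𝓗(x)` and `𝓗(x')`, so the same intersection of horoball
closures is `{x}` and `{x'}`. -/
theorem CompactificationRel.eq_of_tendsto [SeqCompactSpace (EndCompactification K)] {p : Ω}
    (hp : ∀ x ∈ endBoundary K,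
      ⋂ (R : ℝ) (_ : 0 < R), closure (endInclusion K '' bigHorosphere K E p x R) = {x})
    {ξ : metricCompactification (KobayashiSpace E Ω)} {x x' : EndCompactification K}
    (h : CompactificationRel K ξ x) {v : ℕ → Ω}
    (hvξ : Tendsto (fun n => distClass (toKobayashi E (v n))) atTop (𝓝 ξ.1))
    (hvx : Tendsto (fun n => endInclusion K (v n)) atTop (𝓝 x')) : x' = x := by
  rcases h with ⟨z, rfl, rfl⟩ | ⟨hx, hξ⟩
  · exact eq_endInclusion_of_tendsto (tendsto_of_tendsto_distClass_toKobayashi hvξ) hvx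
  · have hx' := mem_endBoundary_of_tendsto hξ.1.2 hvx hvξ
    have h1 := iInter_closure_horoball_eq (hp x hx) hξ
    rw [iInter_closure_horoball_eq (hp x' hx') ⟨hξ.1, v, hvx, hvξ⟩] at h1
    exact singleton_injective h1

theorem CompactificationRel.tendsto [SeqCompactSpace (EndCompactification K)] {p : Ω}
    (hp : ∀ x ∈ endBoundary K,
      ⋂ (R : ℝ) (_ : 0 < R), closure (endInclusion K '' bigHorosphere K E p x R) = {x})
    {ξ : metricCompactification (KobayashiSpace E Ω)} {x : EndCompactification K}
    (h : CompactificationRel K ξ x) {v : ℕ → Ω}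
    (hvξ : Tendsto (fun n => distClass (toKobayashi E (v n))) atTop (𝓝 ξ.1)) :
    Tendsto (fun n => endInclusion K (v n)) atTop (𝓝 x) := by
  refine tendsto_of_subseq_tendsto fun ns hns => ?_
  obtain ⟨x', φ, hφ, hlim⟩ := SeqCompactSpace.tendsto_subseq fun n => endInclusion K (v (ns n))
  exact ⟨φ, h.eq_of_tendsto hp (hvξ.comp (hns.comp hφ.tendsto_atTop)) hlim ▸ hlim⟩

/-- For surjectivity: a sequence of `Ω` tending to `x` subconverges in the metric compactification,
and not to a point of `Ω` if `x` is on the boundary. -/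
theorem exists_compactificationRel_of_end [FirstCountableTopology X]
    [SeqCompactSpace (EndCompactification K)] (x : EndCompactification K) :
    ∃ ξ : metricCompactification (KobayashiSpace E Ω), CompactificationRel K ξ x := by
  by_cases hx : x ∈ endBoundary K
  · have := properSpace_kobayashiSpace (E := E) (M := Ω)
    obtain ⟨v, hv⟩ := exists_seq_tendsto_endInclusion x
    obtain ⟨ξ, hξ, φ, hφ, hlim⟩ := exists_subseq_tendsto_distClass fun n => toKobayashi E (v n)
    have hv' := hv.comp hφ.tendsto_atTop
    refine ⟨⟨ξ, hξ⟩, Or.inr ⟨hx, ⟨hξ, ?_⟩, _, hv', hlim⟩⟩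
    rintro ⟨z, rfl⟩
    exact hx ⟨(toKobayashi E).symm z, (eq_endInclusion_of_tendsto
      (tendsto_of_tendsto_distClass_toKobayashi hlim) hv').symm⟩
  · obtain ⟨z, rfl⟩ := not_not.1 hx
    exact ⟨_, Or.inl ⟨z, rfl, rfl⟩⟩

end Domain

theorem mainTheorem10 {E : Type*} [NormedAddCommGroup E] [NormedSpace ℂ E] [FiniteDimensional ℂ E]
    {X : Type*} [TopologicalSpace X] [T2Space X] [SecondCountableTopology X]
    [ChartedSpace E X] [IsManifold 𝓘(ℂ, E) ω X]
    (Ω : TopologicalSpace.Opens X) (hΩ : (Ω : Set X) ≠ univ) [ConnectedSpace Ω]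
    [KobayashiHyperbolic E Ω] [CompleteSpace (KobayashiSpace E Ω)]
    (K : CompactExhaustion (closure (Ω : Set X))) [SeqCompactSpace (EndCompactification K)]
    (p : Ω)
    (hp : ∀ x ∈ endBoundary K,
      ⋂ (R : ℝ) (_ : 0 < R), closure (endInclusion K '' bigHorosphere K E p x R) = {x}) :
    (∀ x ∈ endBoundary K, ∀ ξ ∈ horoFiber K E x,
      ⋂ (R : ℝ) (_ : 0 < R), closure (endInclusion K ''
        (toKobayashi E ⁻¹' horoball (toKobayashi E p) ξ R)) = {x}) ∧
    ∃ F : metricCompactification (KobayashiSpace E Ω) → EndCompactification K,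
      Continuous F ∧ Function.Surjective F ∧
        ∀ z : Ω, F (toMetricCompactification (toKobayashi E z)) = endInclusion K z := by
  have : ProperSpace E := FiniteDimensional.proper ℂ E
  have : LocallyCompactSpace X := ChartedSpace.locallyCompactSpace E X
  have : LocallyCompactSpace Ω := Ω.isOpen.locallyCompactSpace
  have : LocallyCompactSpace (closure (Ω : Set X)) := isClosed_closure.locallyCompactSpace
  have := properSpace_kobayashiSpace (E := E) (M := Ω)
  have := firstCountableTopology_modConstants (S := KobayashiSpace E Ω)
  refine ⟨fun x hx ξ hξ => iInter_closure_horoball_eq (hp x hx) hξ, ?_⟩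
  choose F hF using exists_compactificationRel (E := E) (K := K)
  have hconst : ∀ (ξ : metricCompactification (KobayashiSpace E Ω)) (v : ℕ → Ω),
      Tendsto (fun n => toMetricCompactification (toKobayashi E (v n))) atTop (𝓝 ξ) →
        Tendsto (fun n => endInclusion K (v n)) atTop (𝓝 (F ξ)) := fun ξ v hv =>
    (hF ξ).tendsto hp (tendsto_subtype_rng.1 hv)
  -- The constant sequence `z` tends to both sides.
  have hinc : ∀ z : Ω, F (toMetricCompactification (toKobayashi E z)) = endInclusion K z :=
    fun z => eq_endInclusion_of_tendsto (tendsto_const_nhds (x := z))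
      (hconst _ (fun _ => z) tendsto_const_nhds)
  refine ⟨F, continuous_iff_continuousAt.2 fun ξ =>
    EndCompactification.continuousAt_of_tendsto_point
      (i := fun z : Ω => toMetricCompactification (toKobayashi E z))
      (g := fun z : Ω => (⟨z, subset_closure z.2⟩ : closure (Ω : Set X))) ?_ hconst, fun x => ?_, hinc⟩
  · intro ξ
    rw [closure_subtype]
    convert ξ.2
    rw [← range_comp]
    exact congrArg closure <| (toKobayashi E (M := Ω)).surjective.range_comp distClass
  · obtain ⟨ξ, hξ⟩ := exists_compactificationRel_of_end (E := E) x
    refine ⟨ξ, ?_⟩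
    rcases hξ with ⟨z, rfl, rfl⟩ | ⟨-, hξ⟩
    · exact hinc z
    -- The sequence witnessing `ξ ∈ 𝓗(x)` tends to `x`, and its limit is forced to be `F ξ`.
    · obtain ⟨-, u, hux, huξ⟩ := id hξ
      exact ((hF ξ).eq_of_tendsto hp huξ hux).symm
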